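/- Let $k$ be a field, let $n \ge 0$, and give $\mathbb R^n$ the product order ($x \le y$ iff $x_i \le y_i$ for all $i$). A persistence module $M : \mathbb R^n \to \mathrm{vec}$ is a functor from the poset $\mathbb R^n$ to finite dimensional $k$-vector spaces; its Hilbert function is $\dim(M) : \mathbb R^n \to \mathbb Z$, $x \mapsto \dim_k M(x)$. For $x \in \mathbb R^n$, let $P_x$ be the persistence module with $P_x(y) = k$ if $y \ge x$ and $P_x(y) = 0$ otherwise, whose structure maps between nonzero values are the identity. A persistence module is finitely generated projective if it is isomorphic to a finite direct sum of modules of the form $P_x$, and finitely presentable if it is isomorphic to the cokernel of a morphism between two finitely generated projective modules. Let $\mathcal M(\mathbb R^n)$ be the space of finite signed Borel measures on $\mathbb R^n$; a finite signed point measure is an element of $\mathcal M(\mathbb R^n)$ that is a finite sum of measures of the form $\delta_x$ or $-\delta_x$ with $x \in \mathbb R^n$. Proposition. Let $M : \mathbb R^n \to \mathrm{vec}$ be finitely presentable. There exists a unique finite signed point measure $\mu_M \in \mathcal M(\mathbb R^n)$ such that $$\dim(M(x)) = \mu_M\big(\{y \in \mathbb R^n : y \le x\}\big) \quad \text{for all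 } x \in \mathbb R^n,$$ and $\mu_M$ is in fact the only element of $\mathcal M(\mathbb R^n)$ with this property. Moreover, there exist finitely generated projective modules $P, Q$ with $\dim(M) = \dim(P) - \dim(Q)$ as functions on $\mathbb R^n$ (a Hilbert decomposition of $M$), and for every such pair $(P,Q)$ and all finite lists $(x_i)_{i \in I}$, $(y_j)_{j \in J}$ of points of $\mathbb R^n$ with $P \cong \bigoplus_{i \in I} P_{x_i}$ and $Q \cong \bigoplus_{j \in J} P_{y_j}$, one has $$\mu_M = \sum_{i \in I} \delta_{x_i} - \sum_{j \in J} \delta_{y_j}.$$ -/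

import Mathlib

open CategoryTheory CategoryTheory.Limits MeasureTheory

universe u

/-- The set `ℝⁿ` regarded as a poset, with the product order: `x ≤ y` iff `x i ≤ y i` for all `i`.
The separate name makes sure that it is regarded as a category in the standard way for a poset
(exactly one arrow `x ⟶ y` if `x ≤ y`, none otherwise). -/
def RealPoset (n : ℕ) : Type := Fin n → ℝ

instance (n : ℕ) : PartialOrder (RealPoset n) :=
  inferInstanceAs (PartialOrder (Fin n → ℝ))

/-- An `n`-parameter persistence module over the field `k`: a functor from the poset `ℝⁿ`
to finite dimensional `k`-vector spaces. -/
abbrev PersistenceModule (k : Type u) [Field k] (n : ℕ) :=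
  RealPoset n ⥤ FGModuleCat.{u} k

namespace PersistenceModule

instance (k : Type u) [Field k] (n : ℕ) : HasFiniteBiproducts (PersistenceModule k n) :=
  HasFiniteBiproducts.of_hasFiniteCoproducts

variable {k : Type u} [Field k] {n : ℕ}

/-- The Hilbert function (dimension vector) `dim M : ℝⁿ → ℤ`. -/
noncomputable def hilbert (M : PersistenceModule k n) (x : RealPoset n) : ℤ :=
  Module.finrank k (M.obj x)

variable (k) in
open Classical in
/-- The value at `y` of the module `P_x`: all of `k` if `x ≤ y`, and `0` otherwise. -/
noncomputable def principalSpace (x y : RealPoset n) : Submodule k k :=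
  if x ≤ y then ⊤ else ⊥

variable (k) in
theorem principalSpace_mono (x : RealPoset n) : Monotone (principalSpace k x) := by
  intro y z hyz
  unfold principalSpace
  split_ifs with h₁ h₂
  · exact le_rfl
  · exact absurd (h₁.trans hyz) h₂
  · exact bot_le
  · exact le_rfl

variable (k) in
/-- The persistence module `P_x`, with `P_x(y) = k` if `x ≤ y` and `P_x(y) = 0` otherwise; its
structure maps are the inclusions of subspaces of `k`, that is, the identity of `k` between any
two nonzero values. -/
noncomputable def principal (x : RealPoset n) : PersistenceModule k n :=
  { obj := fun y => FGModuleCat.of k (principalSpace k x y)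
    map := fun {_ _} f =>
      FGModuleCat.ofHom (Submodule.inclusion (principalSpace_mono k x (leOfHom f)))
    map_id := fun _ => rfl
    map_comp := fun _ _ => rfl }

variable (k) in
/-- The finite direct sum `P_{x 0} ⊕ ⋯ ⊕ P_{x (p-1)}` attached to a finite list of points. -/
noncomputable def directSum {p : ℕ} (x : Fin p → RealPoset n) : PersistenceModule k n :=
  ⨁ fun i => principal k (x i)

/-- Finitely generated projective: (isomorphic to) a finite direct sum of modules `P_x`. -/
def IsFGProjective (P : PersistenceModule k n) : Prop :=
  ∃ (p : ℕ) (x : Fin p → RealPoset n), Nonempty (P ≅ directSum k x)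

/-- Finitely presentable: isomorphic to the cokernel of a morphism between two finitely generated
projective modules. -/
def IsFinitelyPresentable (M : PersistenceModule k n) : Prop :=
  ∃ (Q P : PersistenceModule k n) (f : Q ⟶ P),
    IsFGProjective Q ∧ IsFGProjective P ∧ Nonempty (M ≅ cokernel f)

/-- `(P, Q)` is a Hilbert decomposition of `M`: both are finitely generated projective, and
`dim M = dim P - dim Q` as functions `ℝⁿ → ℤ`. -/
def IsHilbertDecomposition (M P Q : PersistenceModule k n) : Prop :=
  IsFGProjective P ∧ IsFGProjective Q ∧ ∀ x, M.hilbert x = P.hilbert x - Q.hilbert x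

end PersistenceModule

/-- The Dirac measure `δ_x` on `ℝⁿ`, as a finite signed Borel measure. -/
noncomputable def diracSigned {n : ℕ} (x : Fin n → ℝ) : SignedMeasure (Fin n → ℝ) :=
  (Measure.dirac x).toSignedMeasure

/-- A finite signed point measure: a finite sum of signed Dirac measures `δ_x` or `-δ_x`. -/
def IsFiniteSignedPointMeasure {n : ℕ} (μ : SignedMeasure (Fin n → ℝ)) : Prop :=
  ∃ (m : ℕ) (ε : Fin m → ℝ) (x : Fin m → (Fin n → ℝ)),
    (∀ i, ε i = 1 ∨ ε i = -1) ∧ μ = ∑ i, ε i • diracSigned (x i)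

/-! A finite signed measure is determined by its values on the orthants `Set.Iic x`
(`signedMeasure_ext_of_Iic`), and `P_x` has the same Hilbert function as `δ_x` has distribution
function. Everything therefore reduces to the existence of one Hilbert decomposition; any other
gives a measure with the same orthant values. No free resolution is needed for existence. Let `S` be
the finite set of generator and relation degrees of a presentation. Then `dim M(z)` depends only on
which points of `S` lie below `z`, and vanishes if none do. By `exists_signed_points_of_finite`,
every such function is an integer combination of indicators of sets `Set.Ici a`, where `a` may be a
join of points of `S`; splitting by sign gives `P` and `Q`. -/

/-! ### Signed measures and lower orthants. -/

section SignedMeasure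

variable {n : ℕ}

theorem isPiSystem_range_Iic_pi :
    IsPiSystem (Set.range (Set.Iic : (Fin n → ℝ) → Set (Fin n → ℝ))) := by
  rintro _ ⟨x, rfl⟩ _ ⟨y, rfl⟩ _
  exact ⟨x ⊓ y, Set.Iic_inter_Iic.symm⟩

theorem measurableSpace_pi_eq_generateFrom_Iic :
    (inferInstance : MeasurableSpace (Fin n → ℝ)) =
      MeasurableSpace.generateFrom (Set.range Set.Iic) := by
  have h : ∀ _ : Fin n, IsCountablySpanning (Set.range (Set.Iic : ℝ → Set ℝ)) := fun _ =>
    ⟨fun m => Set.Iic (m : ℝ), fun m => ⟨m, rfl⟩,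
      Set.iUnion_eq_univ_iff.2 fun x => exists_nat_ge x⟩
  refine (generateFrom_eq_pi (fun _ => ?_) h).symm.trans ?_
  · rw [← borel_eq_generateFrom_Iic]
    exact BorelSpace.measurable_eq.symm
  · congr 1
    ext s
    constructor
    · rintro ⟨t, ht, rfl⟩
      choose x hx using fun i => ht i (Set.mem_univ i)
      exact ⟨x, by rw [← Set.pi_univ_Iic]; simp only [hx]⟩
    · rintro ⟨x, rfl⟩
      exact ⟨fun i => Set.Iic (x i), fun i _ => ⟨x i, rfl⟩, Set.pi_univ_Iic x⟩

theorem signedMeasure_ext_of_Iic {μ ν : SignedMeasure (Fin n → ℝ)}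
    (h : ∀ x, μ (Set.Iic x) = ν (Set.Iic x)) : μ = ν := by
  -- The complement step of the π-λ argument needs equal total masses, obtained as limits along the
  -- orthants with corner `(m, …, m)`.
  have huniv : μ Set.univ = ν Set.univ := by
    have hmono : Monotone fun m : ℕ => Set.Iic (fun _ : Fin n => (m : ℝ)) := fun a b hab =>
      Set.Iic_subset_Iic.2 fun _ => Nat.cast_le.2 hab
    have hU : (⋃ m : ℕ, Set.Iic (fun _ : Fin n => (m : ℝ))) = Set.univ := by
      refine Set.iUnion_eq_univ_iff.2 fun x => ?_
      obtain ⟨m, hm⟩ := exists_nat_ge (∑ i, |x i|)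
      exact ⟨m, fun i => (le_abs_self _).trans <| (Finset.single_le_sum
        (f := fun i => |x i|) (fun i _ => abs_nonneg (x i)) (Finset.mem_univ i)).trans hm⟩
    have hμ := VectorMeasure.tendsto_vectorMeasure_iUnion_atTop_nat (v := μ) hmono
      fun _ => measurableSet_Iic
    have hν := VectorMeasure.tendsto_vectorMeasure_iUnion_atTop_nat (v := ν) hmono
      fun _ => measurableSet_Iic
    rw [hU] at hμ hν
    refine tendsto_nhds_unique hμ (hν.congr fun m => (h _).symm)
  refine VectorMeasure.ext fun s hs => ?_
  induction s, hs using MeasurableSpace.induction_on_inter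
    measurableSpace_pi_eq_generateFrom_Iic isPiSystem_range_Iic_pi with
  | empty => simp
  | basic t ht => obtain ⟨x, rfl⟩ := ht; exact h x
  | compl t ht ih => rw [VectorMeasure.of_compl ht, VectorMeasure.of_compl ht, ih, huniv]
  | iUnion f hd hm ih =>
    rw [VectorMeasure.of_disjoint_iUnion hm hd, VectorMeasure.of_disjoint_iUnion hm hd]
    exact tsum_congr ih

open Classical in
theorem diracSigned_Iic (x z : Fin n → ℝ) :
    diracSigned x (Set.Iic z) = if x ≤ z then 1 else 0 := by
  rw [diracSigned, Measure.toSignedMeasure_apply_measurable measurableSet_Iic,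
    measureReal_def, Measure.dirac_apply' _ measurableSet_Iic]
  by_cases h : x ≤ z <;> simp [h]

open Classical in
theorem sum_diracSigned_Iic {p : ℕ} (x : Fin p → Fin n → ℝ) (z : Fin n → ℝ) :
    (∑ i, diracSigned (x i)) (Set.Iic z) = ∑ i, if x i ≤ z then 1 else 0 := by
  rw [← FunLike.coeAddMonoidHom_apply, map_sum, Finset.sum_apply]
  exact Finset.sum_congr rfl fun i _ => diracSigned_Iic (x i) z

theorem isFiniteSignedPointMeasure_sum_sub_sum {p q : ℕ} (x : Fin p → Fin n → ℝ)
    (y : Fin q → Fin n → ℝ) :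
    IsFiniteSignedPointMeasure (∑ i, diracSigned (x i) - ∑ j, diracSigned (y j)) := by
  refine ⟨p + q, Fin.append (fun _ => 1) (fun _ => -1), Fin.append x y, fun i => ?_, ?_⟩
  · induction i using Fin.addCases <;> simp
  · simp only [Fin.sum_univ_add, Fin.append_left, Fin.append_right, one_smul, sub_eq_add_neg,
      ← Finset.sum_neg_distrib]
    exact congrArg _ (Finset.sum_congr rfl fun j _ => (neg_one_smul ℝ _).symm)

end SignedMeasure

/-! ### Integer combinations of indicators of principal up-sets. -/

section UpperIndicators

variable {α : Type*} [SemilatticeSup α]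

variable (α) in
/-- The integer combinations of the indicator functions of the sets `{z | a ≤ z}`. -/
def upperIndicatorSpan : AddSubgroup (α → ℤ) :=
  AddSubgroup.closure (Set.range fun a => (Set.Ici a).indicator 1)

/-- Joins enter here: `Set.Ici a ∩ Set.Ici b = Set.Ici (a ⊔ b)`. -/
theorem indicator_mul_mem_upperIndicatorSpan (a : α) {h : α → ℤ}
    (hh : h ∈ upperIndicatorSpan α) :
    (Set.Ici a).indicator 1 * h ∈ upperIndicatorSpan α := by
  refine (AddSubgroup.closure_le ((upperIndicatorSpan α).comap
    (AddMonoidHom.mulLeft ((Set.Ici a).indicator 1)))).2 ?_ hh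
  rintro _ ⟨b, rfl⟩
  refine AddSubgroup.subset_closure ⟨a ⊔ b, ?_⟩
  simp only [AddMonoidHom.coe_mulLeft, ← Set.Ici_inter_Ici, Set.inter_indicator_one]

open Classical in
theorem comp_filter_sub_mem_upperIndicatorSpan (S : Finset α) (H : Finset α → ℤ) :
    (fun z => H (S.filter (· ≤ z)) - H ∅) ∈ upperIndicatorSpan α := by
  induction S using Finset.induction_on generalizing H with
  | empty =>
    convert zero_mem (upperIndicatorSpan α) using 1
    ext z
    simp
  | insert s S _ ih =>
    -- Adding `s` changes the function by the indicator of `s ≤ z` times `G` of the old filter; `G`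
    -- minus its value at `∅` is covered by induction, and the constant `G ∅` contributes a multiple
    -- of that indicator.
    let G : Finset α → ℤ := fun T => H (insert s T) - H T
    have hs : (Set.Ici s).indicator 1 ∈ upperIndicatorSpan α :=
      AddSubgroup.subset_closure ⟨s, rfl⟩
    convert add_mem (ih H) (add_mem (indicator_mul_mem_upperIndicatorSpan s (ih G))
      (zsmul_mem hs (G ∅))) using 1
    ext z
    by_cases hz : s ≤ z <;> simp [Finset.filter_insert, hz, G]

open Classical in
theorem exists_signed_points_of_mem_upperIndicatorSpan {h : α → ℤ}
    (hh : h ∈ upperIndicatorSpan α) :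
    ∃ (p q : ℕ) (x : Fin p → α) (y : Fin q → α), ∀ z,
      h z = (∑ i, if x i ≤ z then 1 else 0) - ∑ j, if y j ≤ z then 1 else 0 := by
  induction hh using AddSubgroup.closure_induction with
  | mem _ ha =>
    obtain ⟨a, rfl⟩ := ha
    exact ⟨1, 0, fun _ => a, Fin.elim0, fun z => by simp [Set.indicator_apply]⟩
  | zero => exact ⟨0, 0, Fin.elim0, Fin.elim0, fun z => by simp⟩
  | add f g _ _ hf hg =>
    obtain ⟨p, q, x, y, hf⟩ := hf
    obtain ⟨p', q', x', y', hg⟩ := hg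
    refine ⟨p + p', q + q', Fin.append x x', Fin.append y y', fun z => ?_⟩
    simp only [Pi.add_apply, hf, hg, Fin.sum_univ_add, Fin.append_left, Fin.append_right]
    ring
  | neg f _ hf =>
    obtain ⟨p, q, x, y, hf⟩ := hf
    exact ⟨q, p, y, x, fun z => by rw [Pi.neg_apply, hf, neg_sub]⟩

open Classical in
theorem exists_signed_points_of_finite (S : Finset α) (h : α → ℤ)
    (hS : ∀ z w, S.filter (· ≤ z) = S.filter (· ≤ w) → h z = h w)
    (h0 : ∀ z, S.filter (· ≤ z) = ∅ → h z = 0) :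
    ∃ (p q : ℕ) (x : Fin p → α) (y : Fin q → α), ∀ z,
      h z = (∑ i, if x i ≤ z then 1 else 0) - ∑ j, if y j ≤ z then 1 else 0 := by
  let D : α → Finset α := fun z => S.filter (· ≤ z)
  -- The default value `0` ensures `H ∅ = 0` even when no `z` has `D z = ∅`.
  let H : Finset α → ℤ := Function.extend D h 0
  have hH : ∀ z, H (D z) = h z := fun z =>
    Function.FactorsThrough.extend_apply (fun {z w} e => hS z w e) 0 z
  have hH0 : H ∅ = 0 := by
    by_cases he : ∃ z, D z = ∅
    · obtain ⟨z, hz⟩ := he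
      rw [← hz, hH, h0 z hz]
    · exact Function.extend_apply' _ _ _ he
  refine exists_signed_points_of_mem_upperIndicatorSpan ?_
  convert comp_filter_sub_mem_upperIndicatorSpan S H using 1
  ext z
  rw [hH0, sub_zero]
  exact (hH z).symm

end UpperIndicators

/-! ### Hilbert functions and structure maps of direct sums and cokernels. -/

namespace PersistenceModule

variable {k : Type u} [Field k] {n : ℕ}

theorem hilbert_eq_of_iso {M N : PersistenceModule k n} (e : M ≅ N) (z : RealPoset n) :
    M.hilbert z = N.hilbert z := by
  unfold hilbert
  exact congrArg _ (FGModuleCat.isoToLinearEquiv (e.app z)).finrank_eq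

open Classical in
theorem hilbert_principal (x z : RealPoset n) :
    (principal k x).hilbert z = if x ≤ z then 1 else 0 := by
  change ((Module.finrank k (principalSpace k x z) : ℕ) : ℤ) = _
  by_cases h : x ≤ z
  · rw [show principalSpace k x z = ⊤ from if_pos h, finrank_top, Module.finrank_self, if_pos h,
      Nat.cast_one]
  · rw [show principalSpace k x z = ⊥ from if_neg h, finrank_bot, if_neg h, Nat.cast_zero]

/-- Evaluation at a point, as a functor to all vector spaces. -/
noncomputable abbrev evalModule (z : RealPoset n) : PersistenceModule k n ⥤ ModuleCat.{u} k :=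
  (evaluation _ _).obj z ⋙ forget₂ (FGModuleCat.{u} k) (ModuleCat.{u} k)

open Classical in
theorem hilbert_directSum {p : ℕ} (x : Fin p → RealPoset n) (z : RealPoset n) :
    (directSum k x).hilbert z = ∑ i, if x i ≤ z then 1 else 0 := by
  have e := ((evalModule z).mapBiproduct (fun i => principal k (x i)) ≪≫
    ModuleCat.biproductIsoPi _).toLinearEquiv.finrank_eq
  have h : ∀ i, Module.Finite k (((evalModule z).obj ∘ fun i => principal k (x i)) i) := fun i =>
    inferInstanceAs (Module.Finite k ((principal k (x i)).obj z))
  change ((Module.finrank k ((evalModule z).obj (directSum k x)) : ℕ) : ℤ) = _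
  rw [show Module.finrank k ((evalModule z).obj (directSum k x)) = _ from e]
  erw [Module.finrank_pi_fintype]
  rw [Nat.cast_sum]
  exact Finset.sum_congr rfl fun i _ => hilbert_principal (x i) z

theorem isIso_principal_map {x z w : RealPoset n} (f : z ⟶ w) (h : x ≤ w → x ≤ z) :
    IsIso ((principal k x).map f) := by
  have e : principalSpace k x w = principalSpace k x z := by
    unfold principalSpace
    congr 1
    exact propext ⟨h, fun hz => hz.trans (leOfHom f)⟩
  exact ⟨FGModuleCat.ofHom (Submodule.inclusion e.le), rfl, rfl⟩

theorem isIso_directSum_map {p : ℕ} {x : Fin p → RealPoset n} {z w : RealPoset n} (f : z ⟶ w)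
    (h : ∀ i, x i ≤ w → x i ≤ z) : IsIso ((directSum k x).map f) := by
  have := fun i => isIso_principal_map (k := k) f (h i)
  change IsIso ((⨁ fun i => principal k (x i)).map f)
  have total : ∀ v, ∑ i, (biproduct.π (fun i => principal k (x i)) i).app v ≫
      (biproduct.ι (fun i => principal k (x i)) i).app v = 𝟙 _ := fun v => by
    have := congrArg (fun t => NatTrans.app t v) (biproduct.total (f := fun i => principal k (x i)))
    rw [NatTrans.app_sum] at this
    exact this
  -- The inverse is assembled from the inverses on the summands.
  refine ⟨∑ i, (biproduct.π (fun i => principal k (x i)) i).app w ≫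
    inv ((principal k (x i)).map f) ≫ (biproduct.ι (fun i => principal k (x i)) i).app z, ?_, ?_⟩
  · rw [Preadditive.comp_sum, ← total z]
    refine Finset.sum_congr rfl fun i _ => ?_
    erw [NatTrans.naturality_assoc]
    simp
  · rw [Preadditive.sum_comp, ← total w]
    refine Finset.sum_congr rfl fun i _ => ?_
    simp only [Category.assoc]
    rw [show _ ≫ (⨁ fun i => principal k (x i)).map f = _ from
      ((biproduct.ι (fun i => principal k (x i)) i).naturality f).symm, IsIso.inv_hom_id_assoc]

theorem isIso_map_of_iso {M N : PersistenceModule k n} (e : M ≅ N) {z w : RealPoset n} (f : z ⟶ w)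
    [IsIso (N.map f)] : IsIso (M.map f) := by
  rw [← NatIso.naturality_2 e f]
  infer_instance

theorem hilbert_cokernel {Q P : PersistenceModule k n} (g : Q ⟶ P) (z : RealPoset n) :
    (cokernel g).hilbert z = Module.finrank k (cokernel (g.app z) : FGModuleCat k) := by
  have e : (cokernel g).obj z ≅ cokernel (g.app z) :=
    PreservesCokernel.iso ((evaluation _ _).obj z) g
  exact congrArg _ (FGModuleCat.isoToLinearEquiv e).finrank_eq

theorem hilbert_cokernel_eq_of_isIso {Q P : PersistenceModule k n} (g : Q ⟶ P)
    {z w : RealPoset n} (f : z ⟶ w) [IsIso (Q.map f)] [IsIso (P.map f)] :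
    (cokernel g).hilbert z = (cokernel g).hilbert w := by
  rw [hilbert_cokernel, hilbert_cokernel]
  have e : cokernel (g.app z) ≅ cokernel (g.app w) :=
    cokernel.mapIso _ _ (asIso (Q.map f)) (asIso (P.map f)) (g.naturality f).symm
  exact congrArg _ (FGModuleCat.isoToLinearEquiv e).finrank_eq

theorem hilbert_cokernel_eq_zero {Q P : PersistenceModule k n} (g : Q ⟶ P)
    {z : RealPoset n} (hz : P.hilbert z = 0) : (cokernel g).hilbert z = 0 := by
  have hs : Function.Surjective ((evalModule z).map (cokernel.π g)) :=
    (ModuleCat.epi_iff_surjective _).1 inferInstance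
  have : Module.Finite k ((evalModule z).obj P) := inferInstanceAs (Module.Finite k (P.obj z))
  have h := LinearMap.finrank_le_finrank_of_surjective
    (f := ((evalModule z).map (cokernel.π g)).hom) hs
  unfold hilbert at hz ⊢
  have h' : Module.finrank k ((cokernel g).obj z) ≤ Module.finrank k (P.obj z) := h
  omega

end PersistenceModule

/-! ### Existence of a Hilbert decomposition. -/

namespace PersistenceModule

variable {k : Type u} [Field k] {n : ℕ}

theorem IsFinitelyPresentable.exists_signed_points {M : PersistenceModule k n}
    (hM : M.IsFinitelyPresentable) :
    ∃ (p q : ℕ) (x : Fin p → Fin n → ℝ) (y : Fin q → Fin n → ℝ), ∀ z : RealPoset n,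
      M.hilbert z = (directSum k x).hilbert z - (directSum k y).hilbert z := by
  classical
  obtain ⟨Q, P, g, ⟨q, y, ⟨eQ⟩⟩, ⟨p, x, ⟨eP⟩⟩, ⟨e⟩⟩ := hM
  have cover : ∀ (x : Fin p → Fin n → ℝ) (y : Fin q → Fin n → ℝ),
      ∃ S : Finset (Fin n → ℝ), (∀ i, x i ∈ S) ∧ ∀ j, y j ∈ S := fun x y =>
    ⟨Finset.univ.image x ∪ Finset.univ.image y, by simp, by simp⟩
  obtain ⟨S, hx, hy⟩ := cover x y
  have mono : ∀ z w : Fin n → ℝ, z ≤ w → (∀ s ∈ S, s ≤ w → s ≤ z) →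
      M.hilbert z = M.hilbert w := fun z w hzw h => by
    let f : (show RealPoset n from z) ⟶ w := homOfLE hzw
    have := isIso_directSum_map (k := k) f fun i => h _ (hx i)
    have := isIso_directSum_map (k := k) f fun j => h _ (hy j)
    have := isIso_map_of_iso eP f
    have := isIso_map_of_iso eQ f
    exact (hilbert_eq_of_iso e z).trans
      ((hilbert_cokernel_eq_of_isIso g f).trans (hilbert_eq_of_iso e w).symm)
  obtain ⟨a, b, u, v, huv⟩ := exists_signed_points_of_finite S
    (fun z : Fin n → ℝ => M.hilbert z) (fun z w hzw => by
      have hiff : ∀ s ∈ S, s ≤ z ↔ s ≤ w := Finset.filter_inj'.1 hzw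
      -- `z` and `w` need not be comparable, but `z ⊓ w` lies below both and above the same points
      -- of `S`.
      refine (mono (z ⊓ w) z inf_le_left fun s hs h => ?_).symm.trans
        (mono (z ⊓ w) w inf_le_right fun s hs h => ?_)
      · exact le_inf h ((hiff s hs).1 h)
      · exact le_inf ((hiff s hs).2 h) h)
    (fun z hz => by
      refine (hilbert_eq_of_iso e z).trans (hilbert_cokernel_eq_zero g ?_)
      refine (hilbert_eq_of_iso eP z).trans ((hilbert_directSum x z).trans ?_)
      exact Finset.sum_eq_zero fun i _ => if_neg (Finset.filter_eq_empty_iff.1 hz (hx i)))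
  exact ⟨a, b, u, v, fun z => (huv z).trans
    (congrArg₂ _ (hilbert_directSum u z) (hilbert_directSum v z)).symm⟩

theorem isFGProjective_directSum {p : ℕ} (x : Fin p → RealPoset n) :
    IsFGProjective (directSum k x) :=
  ⟨p, x, ⟨Iso.refl _⟩⟩

theorem hilbert_directSum_eq_diracSigned {p : ℕ} (x : Fin p → Fin n → ℝ) (z : Fin n → ℝ) :
    ((hilbert (directSum k x) z : ℤ) : ℝ) = (∑ i, diracSigned (x i)) (Set.Iic z) := by
  classical
  refine (congrArg _ (hilbert_directSum x z)).trans ?_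
  rw [sum_diracSigned_Iic]
  push_cast
  rfl

end PersistenceModule

theorem mainTheorem4 {k : Type u} [Field k] (n : ℕ) (M : PersistenceModule k n)
    (hM : M.IsFinitelyPresentable) :
    ∃ μ : SignedMeasure (Fin n → ℝ),
      IsFiniteSignedPointMeasure μ ∧
      (∀ x : Fin n → ℝ, (M.hilbert x : ℝ) = μ {y | y ≤ x}) ∧
      (∀ ν : SignedMeasure (Fin n → ℝ),
        (∀ x : Fin n → ℝ, (M.hilbert x : ℝ) = ν {y | y ≤ x}) → ν = μ) ∧
      (∃ P Q : PersistenceModule k n, PersistenceModule.IsHilbertDecomposition M P Q) ∧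
      (∀ P Q : PersistenceModule k n, PersistenceModule.IsHilbertDecomposition M P Q →
        ∀ (p q : ℕ) (x : Fin p → (Fin n → ℝ)) (y : Fin q → (Fin n → ℝ)),
          Nonempty (P ≅ PersistenceModule.directSum k x) →
          Nonempty (Q ≅ PersistenceModule.directSum k y) →
          μ = ∑ i, diracSigned (x i) - ∑ j, diracSigned (y j)) := by
  obtain ⟨p, q, x, y, h⟩ := hM.exists_signed_points
  have measure_eq : ∀ (p q : ℕ) (x : Fin p → (Fin n → ℝ)) (y : Fin q → (Fin n → ℝ)),
      (∀ z : RealPoset n, M.hilbert z = (PersistenceModule.directSum k x).hilbert z -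
        (PersistenceModule.directSum k y).hilbert z) → ∀ z : Fin n → ℝ,
      (M.hilbert z : ℝ) = (∑ i, diracSigned (x i) - ∑ j, diracSigned (y j)) (Set.Iic z) :=
    fun p q x y h z => by
      rw [h z, Int.cast_sub, PersistenceModule.hilbert_directSum_eq_diracSigned,
        PersistenceModule.hilbert_directSum_eq_diracSigned]
      rfl
  refine ⟨_, isFiniteSignedPointMeasure_sum_sub_sum x y, measure_eq p q x y h,
    fun ν hν => signedMeasure_ext_of_Iic fun z => ?_,
    ⟨_, _, PersistenceModule.isFGProjective_directSum x,
      PersistenceModule.isFGProjective_directSum y, h⟩, ?_⟩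
  · exact (hν z).symm.trans (measure_eq p q x y h z)
  · rintro P Q ⟨-, -, hPQ⟩ p' q' x' y' ⟨eP⟩ ⟨eQ⟩
    refine signedMeasure_ext_of_Iic fun z => ?_
    refine (measure_eq p q x y h z).symm.trans (measure_eq p' q' x' y' (fun w => ?_) z)
    rw [hPQ, PersistenceModule.hilbert_eq_of_iso eP, PersistenceModule.hilbert_eq_of_iso eQ]
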